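/- Let $G$ be a locally compact (Hausdorff) group with a fixed left Haar (Radon) measure $dx$, and let $\mathcal H=L^2(G)$. Let $M=L^\infty(G)$ act on $\mathcal H$ by the multiplication operators $\pi_a\xi(x)=a(x)\xi(x)$, and let $\hat M=\mathcal L(G)\subseteq\mathcal B(\mathcal H)$ be the group von Neumann algebra, generated by the left convolution operators $L_b\xi(x)=\int b(z)\xi(z^{-1}x)\,dz$, $b\in C_c(G)$. Let $W$ be the unitary operator on $\mathcal H\otimes\mathcal H=L^2(G\times G)$ given by $W\xi(x,y)=\xi(x,x^{-1}y)$. Let $\varphi$ be the left Haar weight of $M$, $\varphi(\pi_a)=\int a(x)\,dx$ for $a\ge0$, and let $\hat\varphi$ be the left Haar weight (Plancherel weight) of $\hat M$: $\hat\varphi(y^*y)=\|\xi\|_2^2$ if $y\in\hat M$ is the operator of left convolution by a $\xi\in L^2(G)$, i.e. $yf=\xi*f$ for all $f\in C_c(G)$, and $\hat\varphi(T)=\infty$ for every $T\ge 0$ in $\hat M$ that has no such factorisation $T=y^*y$ (so, formally, $\hat\varphi(L_b)=b(1)$). For a weight $\phi$ let $\mathfrak M_\phi$ be the linear span of the positive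 elements of finite weight, to which $\phi$ extends linearly. For $a\in M$ the Fourier transform is $$\mathcal F(a)=(\varphi\otimes\mathrm{id})\bigl(W(a\otimes1)\bigr)\in\hat M ,$$ and for $b\in\hat M$ the inverse Fourier transform is $$\mathcal F^{-1}(b)=(\mathrm{id}\otimes\hat\varphi)\bigl(W^*(1\otimes b)\bigr)\in M ,$$ whenever these slices exist in the following sense. For a von Neumann algebra $N\subseteq\mathcal B(\mathcal H)$, $c\in N$ and a bounded operator $X$ on $\mathcal H\otimes\mathcal H$, the equation $c=(\phi\otimes\mathrm{id})(X)$ means that $\omega(c)=\phi\bigl((\mathrm{id}\otimes\omega)(X)\bigr)$ for every vector functional $\omega=\langle\,\cdot\,\zeta,\eta\rangle$, $\zeta,\eta\in\mathcal H$, with $(\mathrm{id}\otimes\omega)(X)\in\mathfrak M_\phi$, and that these functionals $\omega$ separate the points of $N$ (so that $c$ is unique); $c=(\mathrm{id}\otimes\phi)(X)$ is defined in the same way, with the legs exchanged. Here $N=\hat M$ for $\mathcal F$ and $N=M$ for $\mathcal F^{-1}$. Then: 1. For $a\in C_c(G)$, we have $\pi_a\in M$, the Fourier transform of $\pi_a$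 exists, and $\mathcal F(\pi_a)=L_a\in\hat M$. 2. For $b\in C_c(G)$, we have $L_b\in\hat M$, the inverse Fourier transform of $L_b$ exists, and $\mathcal F^{-1}(L_b)=\pi_b\in M$. Consequently $\mathcal F^{-1}(\mathcal F(\pi_a))=\pi_a$ and $\mathcal F(\mathcal F^{-1}(L_b))=L_b$ for all $a,b\in C_c(G)$. -/

import Mathlib

open MeasureTheory Filter Topology
open scoped ENNReal CompactlySupported InnerProductSpace

namespace LCGroupFourier

noncomputable section

variable {G : Type*} [Group G] [TopologicalSpace G] [IsTopologicalGroup G]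
  [LocallyCompactSpace G] [T2Space G] [MeasurableSpace G] [BorelSpace G]

set_option linter.unusedSectionVars false

/-- The Hilbert space `L²(G)`, for a fixed left Haar measure `μ`. -/
abbrev H (μ : Measure G) : Type _ := Lp ℂ 2 μ

/-- The Hilbert space `H ⊗ H = L²(G × G)`, realised as the space `L²(G; L²(G))` of square
integrable `L²(G)`-valued functions: the function `ξ(x, y)` of two variables is the function
`x ↦ ξ(x, ·)`. This needs no countability assumption on `G`. -/
abbrev HH (μ : Measure G) : Type _ := Lp (H μ) 2 μ

/-- The elementary tensor `ξ ⊗ η`, that is `(x, y) ↦ ξ(x) η(y)`, as a bounded bilinear map;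
the argument `η` comes first. -/
def tensorR (μ : Measure G) : H μ →L[ℂ] H μ →L[ℂ] HH μ :=
  (ContinuousLinearMap.lsmul ℂ ℂ : ℂ →L[ℂ] H μ →L[ℂ] H μ).flip.compLpL₂ 2 μ

/-- The elementary tensor `ξ ⊗ η`, that is `(x, y) ↦ ξ(x) η(y)`. -/
def tensor {μ : Measure G} (ξ η : H μ) : HH μ := tensorR μ η ξ

theorem tensor_ae {μ : Measure G} (ξ η : H μ) : ∀ᵐ x ∂μ, tensor ξ η x = ξ x • η :=
  ContinuousLinearMap.coeFn_compLpL (p := 2) (μ := μ)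
    ((ContinuousLinearMap.lsmul ℂ ℂ : ℂ →L[ℂ] H μ →L[ℂ] H μ).flip η) ξ

/-- The slice `(id ⊗ ω)(X)` by the normal functional `ω = ⟨· ζ, η⟩`, characterised by
`⟨(id ⊗ ω)(X) v, w⟩ = ⟨X (v ⊗ ζ), w ⊗ η⟩`. -/
def sliceSnd {μ : Measure G} (ζ η : H μ) (X : HH μ →L[ℂ] HH μ) : H μ →L[ℂ] H μ :=
  (ContinuousLinearMap.adjoint (tensorR μ η)).comp (X.comp (tensorR μ ζ))

/-- The slice `(ω ⊗ id)(X)` by the normal functional `ω = ⟨· ζ, η⟩`, characterised by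
`⟨(ω ⊗ id)(X) v, w⟩ = ⟨X (ζ ⊗ v), η ⊗ w⟩`. -/
def sliceFst {μ : Measure G} (ζ η : H μ) (X : HH μ →L[ℂ] HH μ) : H μ →L[ℂ] H μ :=
  (ContinuousLinearMap.adjoint ((tensorR μ).flip η)).comp (X.comp ((tensorR μ).flip ζ))

/-! ### Multiplication operators, translations and convolution operators -/

/-- The multiplication operator `π_a`, `(π_a ξ)(x) = a(x) ξ(x)`, for `a ∈ L^∞(G)`. -/
def mulOp {μ : Measure G} (a : Lp ℂ ∞ μ) : H μ →L[ℂ] H μ :=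
  (ContinuousLinearMap.mul ℂ ℂ).holderL μ ∞ 2 2 a

/-- A function `a ∈ C_c(G)` as an element of `L^∞(G)`. -/
def toLinfty (μ : Measure G) [IsFiniteMeasureOnCompacts μ] (a : C_c(G, ℂ)) : Lp ℂ ∞ μ :=
  (a.continuous.memLp_of_hasCompactSupport (μ := μ) (p := ∞) a.hasCompactSupport).toLp a

/-- A function `f ∈ C_c(G)` as an element of `L²(G)`. -/
def toL2 (μ : Measure G) [IsFiniteMeasureOnCompacts μ] (f : C_c(G, ℂ)) : H μ :=
  (f.continuous.memLp_of_hasCompactSupport (μ := μ) (p := 2) f.hasCompactSupport).toLp f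

/-- The operator `π_a` for `a ∈ C_c(G)`. -/
def piOp (μ : Measure G) [IsFiniteMeasureOnCompacts μ] (a : C_c(G, ℂ)) : H μ →L[ℂ] H μ :=
  mulOp (toLinfty μ a)

/-- The left regular representation, `(λ_z ξ)(x) = ξ(z⁻¹ x)`. -/
def leftTranslate {μ : Measure G} [μ.IsMulLeftInvariant] (z : G) (ξ : H μ) : H μ :=
  DomMulAct.mk z⁻¹ • ξ

section Translate

variable {μ : Measure G} [μ.IsMulLeftInvariant]

theorem leftTranslate_ae (z : G) (ξ : H μ) :
    ∀ᵐ x ∂μ, leftTranslate z ξ x = ξ (z⁻¹ * x) :=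
  DomMulAct.smul_Lp_ae_eq (DomMulAct.mk z⁻¹) ξ

theorem leftTranslate_add (z : G) (ξ η : H μ) :
    leftTranslate z (ξ + η) = leftTranslate z ξ + leftTranslate z η :=
  DomMulAct.smul_Lp_add _ _ _

theorem leftTranslate_smul (z : G) (c : ℂ) (ξ : H μ) :
    leftTranslate z (c • ξ) = c • leftTranslate z ξ :=
  smul_comm _ _ _

theorem norm_leftTranslate (z : G) (ξ : H μ) : ‖leftTranslate z ξ‖ = ‖ξ‖ :=
  DomMulAct.norm_smul_Lp _ _

end Translate

variable (μ : Measure G) [μ.IsHaarMeasure] [μ.Regular]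

theorem continuous_leftTranslate (v : H μ) : Continuous fun z : G => leftTranslate z v := by
  have : Fact ((2 : ℝ≥0∞) ≠ ∞) := ⟨by norm_num⟩
  have h : Continuous fun z : G => DomMulAct.mk z⁻¹ :=
    DomMulAct.continuous_mk.comp continuous_inv
  exact h.smul continuous_const

theorem integrable_leftTranslate (b : C_c(G, ℂ)) (ξ : H μ) :
    Integrable (fun z => b z • leftTranslate z ξ) μ :=
  (b.continuous.smul (continuous_leftTranslate μ ξ)).integrable_of_hasCompactSupport
    b.hasCompactSupport.smul_right

/-- The left convolution operator `L_b`, `b ∈ C_c(G)`, on `L²(G)`: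
`L_b ξ = ∫ b(z) λ_z ξ dz`, that is `(L_b ξ)(x) = ∫ b(z) ξ(z⁻¹ x) dz`. -/
def leftConv (b : C_c(G, ℂ)) : H μ →L[ℂ] H μ :=
  LinearMap.mkContinuous
    { toFun := fun ξ => ∫ z, b z • leftTranslate z ξ ∂μ
      map_add' := fun ξ η => by
        simp_rw [leftTranslate_add, smul_add]
        exact integral_add (integrable_leftTranslate μ b ξ) (integrable_leftTranslate μ b η)
      map_smul' := fun c ξ => by
        simp_rw [leftTranslate_smul, smul_comm _ c, RingHom.id_apply]
        exact integral_smul c _ }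
    (∫ z, ‖b z‖ ∂μ)
    (fun ξ => by
      refine (norm_integral_le_integral_norm _).trans (le_of_eq ?_)
      simp_rw [norm_smul, norm_leftTranslate]
      exact integral_mul_const _ _)

theorem toL2_ae (f : C_c(G, ℂ)) : ∀ᵐ x ∂μ, toL2 μ f x = f x := MemLp.coeFn_toLp _

theorem denseRange_toL2 : DenseRange (toL2 μ : C_c(G, ℂ) → H μ) := by
  have key : ∀ (f : G → ℂ), MemLp f 2 μ → ∀ {ε : ℝ≥0∞}, ε ≠ 0 →
      ∃ g : G → ℂ, eLpNorm (f - g) 2 μ ≤ ε ∧ (Continuous g ∧ HasCompactSupport g) := by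
    intro f hf ε hε
    have h2 : ∀ f g : G → ℂ, Continuous f ∧ HasCompactSupport f →
        Continuous g ∧ HasCompactSupport g → Continuous (f + g) ∧ HasCompactSupport (f + g) :=
      fun f g hf hg => ⟨hf.1.add hg.1, hf.2.add hg.2⟩
    have h3 : ∀ f : G → ℂ, Continuous f ∧ HasCompactSupport f → AEStronglyMeasurable f μ :=
      fun f hf => hf.1.aestronglyMeasurable
    refine MemLp.induction_dense (E := ℂ) ENNReal.ofNat_ne_top
      (fun g => Continuous g ∧ HasCompactSupport g) ?_ h2 h3 hf hε
    intro c t ht htμ ε hε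
    obtain ⟨η, ηpos, hη⟩ := exists_eLpNorm_indicator_le (μ := μ) (p := 2) (by norm_num) c hε
    have hη2 : (η / 2 : ℝ≥0∞) ≠ 0 := (ENNReal.half_pos (ENNReal.coe_pos.2 ηpos).ne').ne'
    obtain ⟨s, st, hs, hsc, hsμ⟩ := ht.exists_isCompact_isClosed_sdiff_lt htμ.ne hη2
    obtain ⟨V, sV, hV, hVμ⟩ := hs.exists_isOpen_lt_add (μ := μ) hη2
    obtain ⟨f, hf1, hf0, hfs, hf⟩ := exists_continuous_one_zero_of_isCompact hs hV.isClosed_compl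
      (Set.disjoint_compl_right_iff_subset.2 sV)
    refine ⟨fun x => (f x : ℂ) * c, ?_, by fun_prop, ?_⟩
    · refine le_trans (eLpNorm_mono (g := ((t \ s) ∪ (V \ s)).indicator fun _ => c) fun x => ?_)
        (hη _ ?_)
      · by_cases hxs : x ∈ s
        · simp [hf1 hxs, st hxs]
        · by_cases hxV : x ∈ V
          · have hmem : x ∈ (t \ s) ∪ (V \ s) := Or.inr ⟨hxV, hxs⟩
            rw [Set.indicator_of_mem hmem]
            have h01 := hf x
            by_cases hxt : x ∈ t
            · have h2 : (f x : ℂ) * c - c = ((f x - 1 : ℝ) : ℂ) * c := by push_cast; ring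
              simp only [Pi.sub_apply, Set.indicator_of_mem hxt, h2, norm_mul, Complex.norm_real]
              refine mul_le_of_le_one_left (norm_nonneg _) ?_
              rw [Real.norm_eq_abs, abs_le]
              constructor <;> linarith [h01.1, h01.2]
            · simp only [Pi.sub_apply, Set.indicator_of_notMem hxt, sub_zero, norm_mul,
                Complex.norm_real]
              refine mul_le_of_le_one_left (norm_nonneg _) ?_
              rw [Real.norm_eq_abs, abs_le]
              constructor <;> linarith [h01.1, h01.2]
          · by_cases hxt : x ∈ t
            · have hmem : x ∈ (t \ s) ∪ (V \ s) := Or.inl ⟨hxt, hxs⟩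
              simp [Set.indicator_of_mem hmem, hf0 hxV, hxt]
            · simp [hf0 hxV, hxt]
      · refine (measure_union_le _ _).trans ?_
        rw [← ENNReal.add_halves (η : ℝ≥0∞)]
        refine add_le_add hsμ.le ?_
        rw [measure_sdiff sV hs.measurableSet.nullMeasurableSet hs.measure_lt_top.ne]
        exact tsub_le_iff_left.2 hVμ.le
    · have : HasCompactSupport fun x => ((f x : ℝ) : ℂ) :=
        hfs.comp_left (g := fun r : ℝ => (r : ℂ)) Complex.ofReal_zero
      exact this.mul_right
  intro ξ
  rw [EMetric.mem_closure_iff]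
  intro ε hε
  by_cases htop : ε = ∞
  · exact ⟨toL2 μ 0, Set.mem_range_self _, by rw [htop]; exact edist_lt_top _ _⟩
  obtain ⟨g, hle, hc, hg⟩ := key ξ (Lp.memLp ξ) (ENNReal.half_pos hε.ne').ne'
  refine ⟨toL2 μ ⟨⟨g, hc⟩, hg⟩, Set.mem_range_self _,
    lt_of_le_of_lt ?_ (ENNReal.half_lt_self hε.ne' htop)⟩
  rw [Lp.edist_def]
  refine (eLpNorm_congr_ae ?_).trans_le hle
  filter_upwards [toL2_ae μ (⟨⟨g, hc⟩, hg⟩ : C_c(G, ℂ))] with x hx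
  simp only [Pi.sub_apply, hx]
  rfl

/-- The pointwise formula `(L_b f)(x) = ∫ b(z) f(z⁻¹ x) dz`. -/
theorem leftConv_ae (b f : C_c(G, ℂ)) :
    ∀ᵐ x ∂μ, leftConv μ b (toL2 μ f) x = ∫ z, b z * f (z⁻¹ * x) ∂μ := by
  set g : G → ℂ := fun x => ∫ z, b z * f (z⁻¹ * x) ∂μ with hg
  have hbK : IsCompact (tsupport b) := b.hasCompactSupport
  have hfK : IsCompact (tsupport f) := f.hasCompactSupport
  have hcont : Continuous fun p : G × G => b p.2 * f (p.2⁻¹ * p.1) :=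
    (b.continuous.comp continuous_snd).mul
      (f.continuous.comp ((continuous_inv.comp continuous_snd).mul continuous_fst))
  have hgc : Continuous g := by
    rw [← continuousOn_univ]
    refine continuousOn_integral_of_compact_support hbK hcont.continuousOn fun x z _ hz => ?_
    rw [image_eq_zero_of_notMem_tsupport hz, zero_mul]
  have hgs : HasCompactSupport g := by
    refine HasCompactSupport.intro (hbK.mul hfK) fun x hx => ?_
    rw [hg]
    refine integral_eq_zero_of_ae (Eventually.of_forall fun z => ?_)
    by_cases hz : z ∈ tsupport b
    · have : z⁻¹ * x ∉ tsupport f := fun h => hx ⟨z, hz, _, h, by simp⟩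
      simp [image_eq_zero_of_notMem_tsupport this]
    · simp [image_eq_zero_of_notMem_tsupport hz]
  suffices h : leftConv μ b (toL2 μ f) = toL2 μ ⟨⟨g, hgc⟩, hgs⟩ by
    rw [h]
    exact toL2_ae μ _
  refine ext_inner_left ℂ fun ξ => ?_
  refine (denseRange_toL2 μ).induction_on (p := fun h : H μ => ⟪h, leftConv μ b (toL2 μ f)⟫_ℂ =
    ⟪h, toL2 μ ⟨⟨g, hgc⟩, hgs⟩⟫_ℂ) ξ (isClosed_eq (by fun_prop) (by fun_prop)) fun h => ?_
  have hL : ⟪toL2 μ h, leftConv μ b (toL2 μ f)⟫_ℂ =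
      ∫ z, ∫ x, b z * f (z⁻¹ * x) * star (h x) ∂μ ∂μ := by
    change ⟪toL2 μ h, ∫ z, b z • leftTranslate z (toL2 μ f) ∂μ⟫_ℂ = _
    rw [← integral_inner (integrable_leftTranslate μ b _)]
    refine integral_congr_ae (Eventually.of_forall fun z => ?_)
    simp only [inner_smul_right]
    rw [L2.inner_def, ← integral_const_mul]
    refine integral_congr_ae ?_
    have h1 := (measurePreserving_mul_left μ z⁻¹).quasiMeasurePreserving.ae (toL2_ae μ f)
    filter_upwards [toL2_ae μ h, leftTranslate_ae z (toL2 μ f), h1] with x hx hx' hx''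
    rw [hx, hx', hx'']
    simp [mul_assoc]
  have hR : ⟪toL2 μ h, toL2 μ ⟨⟨g, hgc⟩, hgs⟩⟫_ℂ =
      ∫ x, ∫ z, b z * f (z⁻¹ * x) * star (h x) ∂μ ∂μ := by
    rw [L2.inner_def]
    refine integral_congr_ae ?_
    filter_upwards [toL2_ae μ h, toL2_ae μ (⟨⟨g, hgc⟩, hgs⟩ : C_c(G, ℂ))] with x hx hx'
    rw [hx, hx', integral_mul_const]
    rfl
  rw [hL, hR]
  refine integral_integral_swap_of_hasCompactSupport
    (f := fun z x => b z * f (z⁻¹ * x) * star (h x)) ?_ ?_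
  · have := h.continuous
    have := b.continuous
    have := f.continuous
    simp only [Function.uncurry_def]
    fun_prop
  · refine HasCompactSupport.intro (hbK.prod h.hasCompactSupport) fun p hp => ?_
    by_cases hz : p.1 ∈ tsupport b
    · have : p.2 ∉ tsupport h := fun hh => hp ⟨hz, hh⟩
      simp [Function.uncurry_def, image_eq_zero_of_notMem_tsupport this]
    · simp [Function.uncurry_def, image_eq_zero_of_notMem_tsupport hz]

/-! ### The multiplicative unitary -/

theorem aestronglyMeasurable_translate (ξ : HH μ) :
    AEStronglyMeasurable (fun x => leftTranslate x (ξ x)) μ := by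
  obtain ⟨s, hs, hlim⟩ := Lp.finStronglyMeasurable ξ (by norm_num) (by norm_num)
  refine aestronglyMeasurable_of_tendsto_ae atTop
    (f := fun n x => leftTranslate x (s n x)) (fun n => ?_) (Eventually.of_forall fun x => ?_)
  · have hA : MeasurableSet (Function.support (s n)) := (s n).measurableSet_support
    have hex : ∀ k : ℕ, ∃ K ⊆ Function.support (s n), IsCompact K ∧
        μ (Function.support (s n)) < μ K + ((k : ℝ≥0∞) + 1)⁻¹ := fun k =>
      hA.exists_isCompact_lt_add (hs n).ne (by simp)
    choose K hKA hK hKμ using hex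
    have hBA : (⋃ k, K k) ⊆ Function.support (s n) := Set.iUnion_subset hKA
    have hBm : MeasurableSet (⋃ k, K k) := MeasurableSet.iUnion fun k => (hK k).measurableSet
    have hnull : μ (Function.support (s n) \ ⋃ k, K k) = 0 := by
      have hle : μ (Function.support (s n)) ≤ μ (⋃ k, K k) := by
        have h1 : Tendsto (fun k : ℕ => μ (⋃ k, K k) + ((k : ℝ≥0∞) + 1)⁻¹) atTop
            (𝓝 (μ (⋃ k, K k) + 0)) := by
          refine Tendsto.add tendsto_const_nhds ?_
          have := (ENNReal.tendsto_inv_nat_nhds_zero).comp (tendsto_add_atTop_nat 1)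
          refine this.congr fun k => by simp
        rw [add_zero] at h1
        refine ge_of_tendsto' h1 fun k => (hKμ k).le.trans ?_
        gcongr
        exact Set.subset_iUnion K k
      rw [measure_sdiff hBA hBm.nullMeasurableSet ((measure_mono hBA).trans_lt (hs n)).ne]
      exact tsub_eq_zero_of_le hle
    have hres : AEStronglyMeasurable (fun x => leftTranslate x (s n x))
        (μ.restrict (⋃ k, K k)) := by
      rw [aestronglyMeasurable_iUnion_iff]
      intro k
      have heq : (fun x => leftTranslate x (s n x)) = fun x => ∑ v ∈ (s n).range,
          (s n ⁻¹' {v}).indicator (fun x => leftTranslate x v) x := by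
        funext x
        rw [Finset.sum_eq_single (s n x)]
        · simp
        · intro v _ hv
          simp [Set.indicator, hv.symm]
        · intro h
          exact absurd (SimpleFunc.mem_range_self _ x) h
      rw [heq]
      refine Finset.aestronglyMeasurable_fun_sum _ fun v _ => ?_
      exact ((continuous_leftTranslate μ v).continuousOn.aestronglyMeasurable_of_isCompact
        (hK k) (hK k).measurableSet).indicator ((s n).measurableSet_fiber v)
    have hind := (aestronglyMeasurable_indicator_iff hBm).2 hres
    refine hind.congr ?_
    have hae : ∀ᵐ x ∂μ, x ∉ Function.support (s n) \ ⋃ k, K k := measure_eq_zero_iff_ae_notMem.1 hnull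
    filter_upwards [hae] with x hx
    by_cases hxB : x ∈ ⋃ k, K k
    · rw [Set.indicator_of_mem hxB]
    · rw [Set.indicator_of_notMem hxB]
      have h0 : s n x = 0 := by
        by_contra h
        exact hx ⟨h, hxB⟩
      rw [h0]
      exact (DomMulAct.smul_Lp_zero (DomMulAct.mk x⁻¹)).symm
  · have hc : Continuous fun v : H μ => leftTranslate x v :=
      continuous_const_smul (DomMulAct.mk x⁻¹)
    exact (hc.tendsto _).comp (hlim x)

theorem memLp_translate (ξ : HH μ) : MemLp (fun x => leftTranslate x (ξ x)) 2 μ :=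
  (Lp.memLp ξ).of_le (aestronglyMeasurable_translate μ ξ)
    (Eventually.of_forall fun x => (norm_leftTranslate x (ξ x)).le)

/-- The multiplicative unitary `W` on `L²(G × G)`, `(W ξ)(x, y) = ξ(x, x⁻¹ y)`: in terms of
`L²(G)`-valued functions of `x`, `(W ξ)(x) = λ_x (ξ(x))`. -/
def W : HH μ →L[ℂ] HH μ :=
  (LinearIsometry.mk (σ₁₂ := RingHom.id ℂ)
    { toFun := fun ξ => (memLp_translate μ ξ).toLp _
      map_add' := fun ξ η => by
        rw [← MemLp.toLp_add]
        refine MemLp.toLp_congr _ _ ?_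
        filter_upwards [Lp.coeFn_add ξ η] with x hx
        rw [hx, Pi.add_apply, leftTranslate_add]
        rfl
      map_smul' := fun c ξ => by
        rw [RingHom.id_apply, ← MemLp.toLp_const_smul]
        refine MemLp.toLp_congr _ _ ?_
        filter_upwards [Lp.coeFn_smul c ξ] with x hx
        rw [hx, Pi.smul_apply, leftTranslate_smul]
        rfl }
    (fun ξ => by
      rw [Lp.norm_def ξ]
      refine (Lp.norm_toLp _ (memLp_translate μ ξ)).trans ?_
      rw [eLpNorm_congr_norm_ae (Eventually.of_forall fun x => norm_leftTranslate x (ξ x))])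
    ).toContinuousLinearMap

theorem W_ae (ξ : HH μ) : ∀ᵐ x ∂μ, W μ ξ x = leftTranslate x (ξ x) :=
  (memLp_translate μ ξ).coeFn_toLp

/-! ### The von Neumann algebras `L^∞(G)` and `𝓛(G)` -/

/-- `M = L^∞(G)`, acting on `L²(G)` by multiplication operators. -/
def Linfty : Set (H μ →L[ℂ] H μ) := Set.range (mulOp (μ := μ))

/-- The von Neumann algebra generated by a set of bounded operators: the bicommutant of the set
together with its adjoints. -/
def vonNeumannGenerated {K : Type*} [NormedAddCommGroup K] [InnerProductSpace ℂ K]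
    [CompleteSpace K] (s : Set (K →L[ℂ] K)) : VonNeumannAlgebra K where
  toStarSubalgebra := StarSubalgebra.centralizer ℂ (StarSubalgebra.centralizer ℂ s : Set (K →L[ℂ] K))
  centralizer_centralizer' := by
    change Set.centralizer (Set.centralizer
      (StarSubalgebra.centralizer ℂ (StarSubalgebra.centralizer ℂ s : Set (K →L[ℂ] K)) :
        Set (K →L[ℂ] K))) =
      (StarSubalgebra.centralizer ℂ (StarSubalgebra.centralizer ℂ s : Set (K →L[ℂ] K)) :
        Set (K →L[ℂ] K))
    rw [StarSubalgebra.coe_centralizer_centralizer, Set.centralizer_centralizer_centralizer]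

/-- The group von Neumann algebra `M̂ = 𝓛(G)`, generated by the operators `L_b`, `b ∈ C_c(G)`.
As these operators form a nondegenerate `*`-algebra, it is the weak operator (equivalently, the
`σ`-weak) closure of `L(C_c(G))`. -/
def groupVN : VonNeumannAlgebra (H μ) := vonNeumannGenerated (Set.range (leftConv μ))

/-! ### The Haar weights -/

/-- The left Haar weight `φ` of `L^∞(G)`: `φ(π_a) = ∫ a(x) dx ∈ [0, ∞]` for `0 ≤ a ∈ L^∞(G)`.
It is `∞` on operators that are not of the form `π_a` with `a ≥ 0`. -/
def haarWeight (T : H μ →L[ℂ] H μ) : ℝ≥0∞ :=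
  ⨅ (a : Lp ℂ ∞ μ) (_ : ∀ᵐ x ∂μ, a x = (‖a x‖ : ℂ)) (_ : T = mulOp a), ∫⁻ x, ‖a x‖ₑ ∂μ

/-- `y` is the operator of left convolution by `ξ ∈ L²(G)`:
`(y f)(x) = ∫ ξ(z) f(z⁻¹ x) dz` for `f ∈ C_c(G)`. -/
def IsLeftConvBy (ξ : H μ) (y : H μ →L[ℂ] H μ) : Prop :=
  ∀ f : C_c(G, ℂ), ∀ᵐ x ∂μ, y (toL2 μ f) x = ∫ z, ξ z * f (z⁻¹ * x) ∂μ

/-- The left Haar weight `φ̂` of `𝓛(G)`, that is, the Plancherel weight: `φ̂(y* y) = ‖ξ‖²` if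
`y ∈ 𝓛(G)` is the operator of left convolution by `ξ ∈ L²(G)`, and `φ̂(T) = ∞` if `T` has
no such factorisation `T = y* y`. (If `b = c^* * c` with `c ∈ C_c(G)`, then
`φ̂(L_b) = ‖c‖₂² = b(1)`.) -/
def dualHaarWeight (T : H μ →L[ℂ] H μ) : ℝ≥0∞ :=
  ⨅ (y : H μ →L[ℂ] H μ) (ξ : H μ) (_ : y ∈ groupVN μ) (_ : IsLeftConvBy μ ξ y)
    (_ : T = (ContinuousLinearMap.adjoint y).comp y), ‖ξ‖ₑ ^ 2

/-- `T` belongs to the definition domain `𝔐_φ`, the linear span of the positive elements of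
finite weight, and the linear extension of the weight `φ` to `𝔐_φ` takes the value `w` at `T`. -/
def HasWeight {K : Type*} [NormedAddCommGroup K] [InnerProductSpace ℂ K]
    (φ : (K →L[ℂ] K) → ℝ≥0∞) (T : K →L[ℂ] K) (w : ℂ) : Prop :=
  ∃ p : Fin 4 → (K →L[ℂ] K), (∀ k, φ (p k) < ∞) ∧
    T = ∑ k : Fin 4, Complex.I ^ (k : ℕ) • p k ∧ w = ∑ k : Fin 4, Complex.I ^ (k : ℕ) * ((φ (p k)).toReal : ℂ)

/-! ### Slices by a weight, and the Fourier transforms -/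

/-- `c = (φ ⊗ id)(X)`, where `φ` is a weight and `c` lies in the von Neumann algebra `N`:
for the vector functionals `ω` such that `(id ⊗ ω)(X)` lies in `𝔐_φ` one has
`ω(c) = φ((id ⊗ ω)(X))`, and these `ω` separate the points of `N` (equivalently, they span a
norm dense subspace of the predual of `N`). -/
def IsWeightSliceFst {μ : Measure G} (φ : (H μ →L[ℂ] H μ) → ℝ≥0∞) (N : Set (H μ →L[ℂ] H μ))
    (X : HH μ →L[ℂ] HH μ) (c : H μ →L[ℂ] H μ) : Prop :=
  c ∈ N ∧
  (∀ ζ η w, HasWeight φ (sliceSnd ζ η X) w → ⟪η, c ζ⟫_ℂ = w) ∧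
  ∀ T ∈ N, (∀ ζ η, (∃ w, HasWeight φ (sliceSnd ζ η X) w) → ⟪η, T ζ⟫_ℂ = 0) → T = 0

/-- `c = (id ⊗ φ)(X)`, where `φ` is a weight and `c` lies in the von Neumann algebra `N`;
see `IsWeightSliceFst`. -/
def IsWeightSliceSnd {μ : Measure G} (φ : (H μ →L[ℂ] H μ) → ℝ≥0∞) (N : Set (H μ →L[ℂ] H μ))
    (X : HH μ →L[ℂ] HH μ) (c : H μ →L[ℂ] H μ) : Prop :=
  c ∈ N ∧
  (∀ ζ η w, HasWeight φ (sliceFst ζ η X) w → ⟪η, c ζ⟫_ℂ = w) ∧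
  ∀ T ∈ N, (∀ ζ η, (∃ w, HasWeight φ (sliceFst ζ η X) w) → ⟪η, T ζ⟫_ℂ = 0) → T = 0

/-- `Y = a ⊗ 1`. -/
def IsAmplFst {μ : Measure G} (a : H μ →L[ℂ] H μ) (Y : HH μ →L[ℂ] HH μ) : Prop :=
  ∀ ξ η : H μ, Y (tensor ξ η) = tensor (a ξ) η

/-- `Y = 1 ⊗ b`. -/
def IsAmplSnd {μ : Measure G} (b : H μ →L[ℂ] H μ) (Y : HH μ →L[ℂ] HH μ) : Prop :=
  ∀ ξ η : H μ, Y (tensor ξ η) = tensor ξ (b η)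

/-- `c` is the Fourier transform `(φ ⊗ id)(W (a ⊗ 1)) ∈ 𝓛(G)` of `a ∈ L^∞(G)`. -/
def IsFourier (a c : H μ →L[ℂ] H μ) : Prop :=
  a ∈ Linfty μ ∧ ∃ Y, IsAmplFst a Y ∧
    IsWeightSliceFst (haarWeight μ) (groupVN μ : Set (H μ →L[ℂ] H μ)) ((W μ).comp Y) c

/-- `c` is the inverse Fourier transform `(id ⊗ φ̂)(W* (1 ⊗ b)) ∈ L^∞(G)` of `b ∈ 𝓛(G)`. -/
def IsInvFourier (b c : H μ →L[ℂ] H μ) : Prop :=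
  b ∈ groupVN μ ∧ ∃ Y, IsAmplSnd b Y ∧
    IsWeightSliceSnd (dualHaarWeight μ) (Linfty μ)
      ((ContinuousLinearMap.adjoint (W μ)).comp Y) c

/-- The domain of the Fourier transform. -/
def fourierDomain : Set (H μ →L[ℂ] H μ) := {a | ∃ c, IsFourier μ a c}

/-- The domain of the inverse Fourier transform. -/
def invFourierDomain : Set (H μ →L[ℂ] H μ) := {b | ∃ c, IsInvFourier μ b c}

open Classical in
/-- The Fourier transform `𝓕(a) = (φ ⊗ id)(W (a ⊗ 1))`, for `a` in its domain. -/
def fourier (a : H μ →L[ℂ] H μ) : H μ →L[ℂ] H μ :=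
  if h : ∃ c, IsFourier μ a c then h.choose else 0

open Classical in
/-- The inverse Fourier transform `𝓕⁻¹(b) = (id ⊗ φ̂)(W* (1 ⊗ b))`, for `b` in its domain. -/
def invFourier (b : H μ →L[ℂ] H μ) : H μ →L[ℂ] H μ :=
  if h : ∃ c, IsInvFourier μ b c then h.choose else 0

end

end LCGroupFourier

namespace LCGroupFourier

noncomputable section

variable {G : Type*} [Group G] [TopologicalSpace G] [IsTopologicalGroup G]
  [LocallyCompactSpace G] [T2Space G] [MeasurableSpace G] [BorelSpace G]

set_option linter.unusedSectionVars false

/-! ### Membership in the von Neumann algebras -/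

theorem subset_vonNeumannGenerated {K : Type*} [NormedAddCommGroup K] [InnerProductSpace ℂ K]
    [CompleteSpace K] (s : Set (K →L[ℂ] K)) :
    s ⊆ (vonNeumannGenerated s : Set (K →L[ℂ] K)) := by
  intro T hT
  change T ∈ StarSubalgebra.centralizer ℂ (StarSubalgebra.centralizer ℂ s : Set (K →L[ℂ] K))
  rw [StarSubalgebra.mem_centralizer_iff]
  intro g hg
  have hg' : g ∈ StarSubalgebra.centralizer ℂ s := hg
  rw [StarSubalgebra.mem_centralizer_iff] at hg'
  have h := hg' T hT
  refine ⟨h.1.symm, ?_⟩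
  have := congrArg star h.2
  simpa using this

theorem mulOp_ae {μ : Measure G} (a : Lp ℂ ∞ μ) (ξ : H μ) :
    ∀ᵐ x ∂μ, mulOp a ξ x = a x * ξ x :=
  (ContinuousLinearMap.mul ℂ ℂ).coeFn_holder (r := 2) a ξ

variable (μ : Measure G) [μ.IsHaarMeasure] [μ.Regular]

theorem leftConv_mem_groupVN (b : C_c(G, ℂ)) : leftConv μ b ∈ groupVN μ :=
  subset_vonNeumannGenerated _ (Set.mem_range_self b)

theorem piOp_mem_Linfty (a : C_c(G, ℂ)) : piOp μ a ∈ Linfty μ := Set.mem_range_self _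

theorem toLinfty_ae (a : C_c(G, ℂ)) : ∀ᵐ x ∂μ, toLinfty μ a x = a x := MemLp.coeFn_toLp _

theorem piOp_ae (a : C_c(G, ℂ)) (ξ : H μ) : ∀ᵐ x ∂μ, piOp μ a ξ x = a x * ξ x := by
  filter_upwards [toLinfty_ae μ a, mulOp_ae (toLinfty μ a) ξ] with x h1 h2
  rw [← h1]
  exact h2

theorem integrable_cc (a : C_c(G, ℂ)) : Integrable a μ :=
  a.continuous.integrable_of_hasCompactSupport a.hasCompactSupport

/-! ### Inner products with slices and convolution operators -/

theorem inner_sliceSnd (ζ η v w : H μ) (X : HH μ →L[ℂ] HH μ) :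
    ⟪w, sliceSnd ζ η X v⟫_ℂ = ⟪tensor w η, X (tensor v ζ)⟫_ℂ :=
  ContinuousLinearMap.adjoint_inner_right (tensorR μ η) w (X (tensorR μ ζ v))

theorem inner_sliceFst (ζ η v w : H μ) (X : HH μ →L[ℂ] HH μ) :
    ⟪w, sliceFst ζ η X v⟫_ℂ = ⟪tensor η w, X (tensor ζ v)⟫_ℂ :=
  ContinuousLinearMap.adjoint_inner_right ((tensorR μ).flip η) w (X ((tensorR μ).flip ζ v))

theorem inner_leftConv_right (c : C_c(G, ℂ)) (u w : H μ) :
    ⟪u, leftConv μ c w⟫_ℂ = ∫ x, c x * ⟪u, leftTranslate x w⟫_ℂ ∂μ := by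
  change ⟪u, ∫ z, c z • leftTranslate z w ∂μ⟫_ℂ = _
  rw [← integral_inner (integrable_leftTranslate μ c w)]
  simp only [inner_smul_right]

theorem inner_leftConv_left (c : C_c(G, ℂ)) (u w : H μ) :
    ⟪leftConv μ c w, u⟫_ℂ = ∫ x, star (c x) * ⟪leftTranslate x w, u⟫_ℂ ∂μ := by
  rw [← inner_conj_symm, inner_leftConv_right, ← integral_conj]
  simp only [map_mul, inner_conj_symm]
  rfl

theorem continuous_leftTranslate_inner (u w : H μ) :
    Continuous fun x : G => ⟪leftTranslate x w, u⟫_ℂ :=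
  (continuous_leftTranslate μ w).inner continuous_const

theorem norm_inner_leftTranslate_le (u w : H μ) (x : G) :
    ‖⟪leftTranslate x w, u⟫_ℂ‖ ≤ ‖w‖ * ‖u‖ := by
  refine (norm_inner_le_norm _ _).trans ?_
  rw [norm_leftTranslate]

theorem inner_toL2 (f : C_c(G, ℂ)) (ξ : H μ) :
    ⟪toL2 μ f, ξ⟫_ℂ = ∫ x, star (f x) * ξ x ∂μ := by
  rw [L2.inner_def]
  refine integral_congr_ae ?_
  filter_upwards [toL2_ae μ f] with x hx
  rw [hx, RCLike.inner_apply', starRingEnd_apply]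

theorem inner_leftTranslate_toL2 (z : G) (f : C_c(G, ℂ)) (ξ : H μ) :
    ⟪leftTranslate z (toL2 μ f), ξ⟫_ℂ = ∫ x, star (f (z⁻¹ * x)) * ξ x ∂μ := by
  rw [L2.inner_def]
  refine integral_congr_ae ?_
  have h1 := (measurePreserving_mul_left μ z⁻¹).quasiMeasurePreserving.ae (toL2_ae μ f)
  filter_upwards [leftTranslate_ae z (toL2 μ f), h1] with x hx hx'
  rw [hx, hx', RCLike.inner_apply', starRingEnd_apply]

theorem norm_toL2_sq (f : C_c(G, ℂ)) : ‖toL2 μ f‖ ^ 2 = ∫ x, ‖f x‖ ^ 2 ∂μ := by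
  have h : ((‖toL2 μ f‖ ^ 2 : ℝ) : ℂ) = ((∫ x, ‖f x‖ ^ 2 ∂μ : ℝ) : ℂ) := by
    have := inner_self_eq_norm_sq_to_K (𝕜 := ℂ) (toL2 μ f)
    push_cast
    rw [← integral_complex_ofReal]
    refine (this.symm.trans (inner_toL2 μ f _)).trans (integral_congr_ae ?_)
    filter_upwards [toL2_ae μ f] with x hx
    rw [hx]
    have := Complex.conj_mul' (f x)
    rw [starRingEnd_apply] at this
    rw [this]
    push_cast
    rfl
  exact_mod_cast h

theorem leftConv_add (b c : C_c(G, ℂ)) : leftConv μ (b + c) = leftConv μ b + leftConv μ c := by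
  ext1 ξ
  change ∫ z, (b z + c z) • leftTranslate z ξ ∂μ =
    ∫ z, b z • leftTranslate z ξ ∂μ + ∫ z, c z • leftTranslate z ξ ∂μ
  simp_rw [add_smul]
  exact integral_add (integrable_leftTranslate μ b ξ) (integrable_leftTranslate μ c ξ)

theorem leftConv_smul (k : ℂ) (b : C_c(G, ℂ)) : leftConv μ (k • b) = k • leftConv μ b := by
  ext1 ξ
  change ∫ z, (k • b z) • leftTranslate z ξ ∂μ = k • ∫ z, b z • leftTranslate z ξ ∂μ
  simp_rw [smul_assoc]
  exact integral_smul k _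

/-! ### Slices of `W (π_a ⊗ 1)` and of `W* (1 ⊗ L_b)` -/

theorem exists_amplFst (a : C_c(G, ℂ)) : ∃ Y, IsAmplFst (piOp μ a) Y := by
  refine ⟨(ContinuousLinearMap.lsmul ℂ ℂ : ℂ →L[ℂ] H μ →L[ℂ] H μ).holderL μ ∞ 2 2 (toLinfty μ a),
    fun ξ η => ?_⟩
  refine Lp.ext ?_
  have h := (ContinuousLinearMap.lsmul ℂ ℂ : ℂ →L[ℂ] H μ →L[ℂ] H μ).coeFn_holder (r := 2)
    (toLinfty μ a) (tensor ξ η)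
  filter_upwards [h, tensor_ae ξ η, tensor_ae (piOp μ a ξ) η, piOp_ae μ a ξ, toLinfty_ae μ a]
    with x h1 h2 h3 h4 h5
  rw [h3, h4, mul_smul, ← h2, ← h5]
  exact h1

theorem exists_amplSnd (b : H μ →L[ℂ] H μ) : ∃ Y, IsAmplSnd b Y := by
  refine ⟨b.compLpL 2 μ, fun ξ η => ?_⟩
  refine Lp.ext ?_
  filter_upwards [b.coeFn_compLpL (p := 2) (μ := μ) (tensor ξ η), tensor_ae ξ η,
    tensor_ae ξ (b η)] with x h1 h2 h3
  rw [h1, h2, h3, map_smul]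

/-- The function `x ↦ a(x) ⟨λ_x ζ, η⟩`. -/
def matrixCoeffMul (a : C_c(G, ℂ)) (ζ η : H μ) : C_c(G, ℂ) where
  toFun x := a x * ⟪η, leftTranslate x ζ⟫_ℂ
  continuous_toFun := a.continuous.mul (continuous_const.inner (continuous_leftTranslate μ ζ))
  hasCompactSupport' := a.hasCompactSupport.mul_right

/-- The slice `(id ⊗ ω)(W (π_a ⊗ 1))` is multiplication by `x ↦ a(x) ω(λ_x)`. -/
theorem sliceSnd_W (a : C_c(G, ℂ)) {Y : HH μ →L[ℂ] HH μ} (hY : IsAmplFst (piOp μ a) Y)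
    (ζ η : H μ) : sliceSnd ζ η ((W μ).comp Y) = piOp μ (matrixCoeffMul μ a ζ η) := by
  ext1 v
  refine ext_inner_left ℂ fun w => ?_
  rw [inner_sliceSnd, ContinuousLinearMap.comp_apply, hY, L2.inner_def, L2.inner_def]
  refine integral_congr_ae ?_
  filter_upwards [tensor_ae w η, tensor_ae (piOp μ a v) ζ, W_ae μ (tensor (piOp μ a v) ζ),
    piOp_ae μ a v, piOp_ae μ (matrixCoeffMul μ a ζ η) v] with x h1 h2 h3 h4 h5
  rw [h1, h3, h2, h5, h4, leftTranslate_smul, inner_smul_left, inner_smul_right,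
    RCLike.inner_apply']
  change _ = _ * (a x * ⟪η, leftTranslate x ζ⟫_ℂ * v x)
  ring

theorem inner_sliceFst_W (b : C_c(G, ℂ)) {Y : HH μ →L[ℂ] HH μ} (hY : IsAmplSnd (leftConv μ b) Y)
    (ζ η v w : H μ) :
    ⟪w, sliceFst ζ η ((ContinuousLinearMap.adjoint (W μ)).comp Y) v⟫_ℂ =
      ∫ x, star (η x) * ζ x * ⟪leftTranslate x w, leftConv μ b v⟫_ℂ ∂μ := by
  rw [inner_sliceFst, ContinuousLinearMap.comp_apply, hY,
    ContinuousLinearMap.adjoint_inner_right, L2.inner_def]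
  refine integral_congr_ae ?_
  filter_upwards [tensor_ae η w, tensor_ae ζ (leftConv μ b v), W_ae μ (tensor η w)] with x h1 h2 h3
  rw [h3, h1, h2, leftTranslate_smul, inner_smul_left, inner_smul_right, starRingEnd_apply]
  ring

/-! ### The Haar weight of `L^∞(G)` -/

theorem ae_eq_zero_of_mulOp_eq_zero {a : Lp ℂ ∞ μ} (ha : Integrable a μ) (h : mulOp a = 0) :
    a =ᵐ[μ] 0 := by
  have h2 : MemLp a 2 μ := by
    rw [memLp_two_iff_integrable_sq_norm (Lp.aestronglyMeasurable a)]
    have hb : ∀ᵐ x ∂μ, ‖‖a x‖‖ ≤ ‖a‖ := by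
      filter_upwards [ae_le_eLpNormEssSup (f := a) (μ := μ)] with x hx
      rw [norm_norm, Lp.norm_def, eLpNorm_exponent_top, ← toReal_enorm]
      exact ENNReal.toReal_mono (Lp.eLpNorm_ne_top a) hx
    refine (ha.norm.bdd_mul (Lp.aestronglyMeasurable a).norm hb).congr ?_
    exact Eventually.of_forall fun x => (sq _).symm
  have h0 : ∀ᵐ x ∂μ, (0 : H μ) x = 0 := Lp.coeFn_zero ℂ 2 μ
  have h1 := mulOp_ae a (h2.toLp a)
  rw [h] at h1
  filter_upwards [h0, h1, h2.coeFn_toLp] with x hx hx' hx''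
  rw [hx'', zero_apply, hx] at hx'
  exact mul_self_eq_zero.1 hx'.symm

theorem haarWeight_mulOp_le {a : Lp ℂ ∞ μ} (ha : ∀ᵐ x ∂μ, a x = (‖a x‖ : ℂ)) :
    haarWeight μ (mulOp a) ≤ ∫⁻ x, ‖a x‖ₑ ∂μ :=
  iInf_le_of_le a (iInf_le_of_le ha (iInf_le _ rfl))

theorem mulOp_sub {a b : Lp ℂ ∞ μ} : mulOp (a - b) = mulOp a - mulOp b :=
  map_sub ((ContinuousLinearMap.mul ℂ ℂ).holderL μ ∞ 2 2) a b

theorem haarWeight_mulOp {a : Lp ℂ ∞ μ} (ha : ∀ᵐ x ∂μ, a x = (‖a x‖ : ℂ))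
    (hi : Integrable a μ) : haarWeight μ (mulOp a) = ∫⁻ x, ‖a x‖ₑ ∂μ := by
  refine le_antisymm (haarWeight_mulOp_le μ ha) (le_iInf fun b => le_iInf fun _ => le_iInf fun h => ?_)
  by_cases hb : ∫⁻ x, ‖b x‖ₑ ∂μ = ∞
  · rw [hb]
    exact le_top
  have hbi : Integrable b μ := ⟨Lp.aestronglyMeasurable b, lt_top_iff_ne_top.2 hb⟩
  have hab : mulOp (a - b) = 0 := by rw [mulOp_sub, h, sub_self]
  have hsub := Lp.coeFn_sub a b
  have h0 := ae_eq_zero_of_mulOp_eq_zero μ ((hi.sub hbi).congr hsub.symm) hab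
  refine (lintegral_congr_ae ?_).le
  filter_upwards [hsub, h0] with x h1 h2
  rw [h1] at h2
  rw [sub_eq_zero.1 h2]

theorem exists_mulOp_of_haarWeight_lt_top {T : H μ →L[ℂ] H μ} (h : haarWeight μ T < ∞) :
    ∃ a : Lp ℂ ∞ μ, Integrable a μ ∧ T = mulOp a ∧
      ((haarWeight μ T).toReal : ℂ) = ∫ x, a x ∂μ := by
  simp only [haarWeight, iInf_lt_iff] at h
  obtain ⟨a, ha, rfl, hfin⟩ := h
  have hi : Integrable a μ := ⟨Lp.aestronglyMeasurable a, hfin⟩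
  refine ⟨a, hi, rfl, ?_⟩
  rw [haarWeight_mulOp μ ha hi, ← integral_norm_eq_lintegral_enorm (Lp.aestronglyMeasurable a),
    ← integral_complex_ofReal]
  exact integral_congr_ae (ha.mono fun x hx => hx.symm)

theorem hasWeight_haarWeight_piOp_unique {f : C_c(G, ℂ)} {w : ℂ}
    (h : HasWeight (haarWeight μ) (piOp μ f) w) : w = ∫ x, f x ∂μ := by
  obtain ⟨p, hp, hT, hw⟩ := h
  choose a hai hpa haw using fun k => exists_mulOp_of_haarWeight_lt_top μ (hp k)
  set s : Lp ℂ ∞ μ := ∑ k : Fin 4, Complex.I ^ (k : ℕ) • a k with hs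
  have hsae : s =ᵐ[μ] fun x => ∑ k : Fin 4, Complex.I ^ (k : ℕ) * a k x := by
    have h1 : ∀ k : Fin 4, (Complex.I ^ (k : ℕ) • a k : Lp ℂ ∞ μ) =ᵐ[μ]
        fun x => Complex.I ^ (k : ℕ) * a k x := fun k => Lp.coeFn_smul _ _
    have h2 := Lp.coeFn_finsetSum Finset.univ fun k : Fin 4 => Complex.I ^ (k : ℕ) • a k
    filter_upwards [h2, ae_all_iff.2 h1] with x hx hx'
    rw [hs, hx, Finset.sum_apply]
    exact Finset.sum_congr rfl fun k _ => hx' k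
  have hint : ∀ k : Fin 4, Integrable (fun x => Complex.I ^ (k : ℕ) * a k x) μ :=
    fun k => (hai k).const_mul _
  have hsi : Integrable s μ := (integrable_finsetSum _ fun k _ => hint k).congr hsae.symm
  have hsT : mulOp (s - toLinfty μ f) = 0 := by
    rw [mulOp_sub, sub_eq_zero]
    refine Eq.trans ?_ hT.symm
    simp_rw [hpa]
    simp only [hs, mulOp, map_sum, map_smul]
  have hfi : Integrable (toLinfty μ f) μ := (integrable_cc μ f).congr
    ((toLinfty_ae μ f).mono fun x hx => hx.symm)
  have hsub := Lp.coeFn_sub s (toLinfty μ f)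
  have h0 := ae_eq_zero_of_mulOp_eq_zero μ ((hsi.sub hfi).congr hsub.symm) hsT
  have hsf : s =ᵐ[μ] f := by
    filter_upwards [hsub, h0, toLinfty_ae μ f] with x h1 h2 h3
    rw [h1] at h2
    rw [← h3]
    exact sub_eq_zero.1 h2
  rw [hw, ← integral_congr_ae hsf, integral_congr_ae hsae, integral_finsetSum _ fun k _ => hint k]
  simp_rw [haw, integral_const_mul]

/-- The four positive parts `f₀, …, f₃` of `f = f₀ + i f₁ - f₂ - i f₃`. -/
def posPart (f : C_c(G, ℂ)) (k : ℕ) : C_c(G, ℂ) where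
  toFun x := (max ((-Complex.I) ^ k * f x).re 0 : ℝ)
  continuous_toFun := by
    have := f.continuous
    fun_prop
  hasCompactSupport' := f.hasCompactSupport.comp_left
    (g := fun z : ℂ => ((max ((-Complex.I) ^ k * z).re 0 : ℝ) : ℂ)) (by simp)

theorem sum_posPart (f : C_c(G, ℂ)) (x : G) :
    ∑ k : Fin 4, Complex.I ^ (k : ℕ) * posPart f k x = f x := by
  have h (k : ℕ) : posPart f k x = (max ((-Complex.I) ^ k * f x).re 0 : ℝ) := rfl
  have hI : (-Complex.I) ^ 3 = Complex.I := by
    rw [neg_pow, Complex.I_pow_three]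
    norm_num
  have h1 (r : ℝ) : max r 0 - max (-r) 0 = r := max_zero_sub_max_neg_zero_eq_self r
  simp only [h, Fin.sum_univ_four]
  have e1 := h1 (f x).re
  have e2 := h1 (f x).im
  apply Complex.ext
  · simp [hI, Complex.I_pow_three]
    linarith
  · simp [hI, Complex.I_pow_three]
    linarith

theorem exists_hasWeight_haarWeight_piOp (f : C_c(G, ℂ)) :
    ∃ w, HasWeight (haarWeight μ) (piOp μ f) w := by
  refine ⟨_, fun k => piOp μ (posPart f k), fun k => ?_, ?_, rfl⟩
  · refine (haarWeight_mulOp_le μ ?_).trans_lt ?_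
    · filter_upwards [toLinfty_ae μ (posPart f k)] with x hx
      rw [hx]
      change ((max _ 0 : ℝ) : ℂ) = (‖((max _ 0 : ℝ) : ℂ)‖ : ℂ)
      rw [Complex.norm_of_nonneg (le_max_right _ _)]
    · exact ((integrable_cc μ (posPart f k)).congr
        ((toLinfty_ae μ _).mono fun x hx => hx.symm)).2
  · ext1 ξ
    refine Lp.ext ?_
    have h1 : ∀ k : Fin 4, (Complex.I ^ (k : ℕ) • piOp μ (posPart f k) ξ : H μ) =ᵐ[μ]
        fun x => Complex.I ^ (k : ℕ) * piOp μ (posPart f k) ξ x := fun k => Lp.coeFn_smul _ _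
    have h2 := Lp.coeFn_finsetSum Finset.univ
      fun k : Fin 4 => Complex.I ^ (k : ℕ) • piOp μ (posPart f k) ξ
    have h3 : ∀ k : Fin 4, ∀ᵐ x ∂μ, piOp μ (posPart f k) ξ x = posPart f k x * ξ x :=
      fun k => piOp_ae μ _ ξ
    filter_upwards [h2, ae_all_iff.2 h1, ae_all_iff.2 h3, piOp_ae μ f ξ] with x h2 h1 h3 h4
    rw [h4, sum_apply]
    simp only [smul_apply]
    rw [h2, Finset.sum_apply]
    simp_rw [h1, h3, ← mul_assoc, ← Finset.sum_mul, sum_posPart]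

theorem isFourier_piOp (a : C_c(G, ℂ)) : IsFourier μ (piOp μ a) (leftConv μ a) := by
  obtain ⟨Y, hY⟩ := exists_amplFst μ a
  refine ⟨piOp_mem_Linfty μ a, Y, hY, leftConv_mem_groupVN μ a, fun ζ η w hw => ?_,
    fun T _ hT => ?_⟩
  · rw [sliceSnd_W μ a hY] at hw
    rw [hasWeight_haarWeight_piOp_unique μ hw, inner_leftConv_right]
    rfl
  · ext1 ζ
    refine ext_inner_left ℂ fun η => ?_
    rw [hT ζ η ?_, zero_apply, inner_zero_right]
    rw [sliceSnd_W μ a hY]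
    exact exists_hasWeight_haarWeight_piOp μ _

theorem IsFourier.unique {a c d : H μ →L[ℂ] H μ} (hc : IsFourier μ a c) (hd : IsFourier μ a d) :
    c = d := by
  obtain ⟨-, Y, hY, hcN, hcv, hcs⟩ := hc
  obtain ⟨-, Z, hZ, hdN, hdv, -⟩ := hd
  refine sub_eq_zero.1 (hcs _ (sub_mem hcN hdN) fun ζ η ⟨w, hw⟩ => ?_)
  have hYZ : sliceSnd ζ η ((W μ).comp Y) = sliceSnd ζ η ((W μ).comp Z) := by
    ext1 v
    refine ext_inner_left ℂ fun u => ?_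
    simp only [inner_sliceSnd, ContinuousLinearMap.comp_apply, hY v ζ, hZ v ζ]
  rw [sub_apply, inner_sub_right, hcv ζ η w hw, hdv ζ η w (hYZ ▸ hw), sub_self]

theorem IsInvFourier.unique {b c d : H μ →L[ℂ] H μ} (hc : IsInvFourier μ b c)
    (hd : IsInvFourier μ b d) : c = d := by
  obtain ⟨-, Y, hY, ⟨f, rfl⟩, hcv, hcs⟩ := hc
  obtain ⟨-, Z, hZ, ⟨g, rfl⟩, hdv, -⟩ := hd
  refine sub_eq_zero.1 (hcs _ ⟨f - g, mulOp_sub μ⟩ fun ζ η ⟨w, hw⟩ => ?_)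
  have hYZ : sliceFst ζ η ((ContinuousLinearMap.adjoint (W μ)).comp Y) =
      sliceFst ζ η ((ContinuousLinearMap.adjoint (W μ)).comp Z) := by
    ext1 v
    refine ext_inner_left ℂ fun u => ?_
    simp only [inner_sliceFst, ContinuousLinearMap.comp_apply, hY ζ v, hZ ζ v]
  rw [sub_apply, inner_sub_right, hcv ζ η w hw, hdv ζ η w (hYZ ▸ hw), sub_self]

theorem IsFourier.fourier_eq {a c : H μ →L[ℂ] H μ} (h : IsFourier μ a c) : fourier μ a = c := by
  have he : ∃ c, IsFourier μ a c := ⟨c, h⟩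
  rw [fourier, dif_pos he]
  exact he.choose_spec.unique μ h

theorem IsInvFourier.invFourier_eq {b c : H μ →L[ℂ] H μ} (h : IsInvFourier μ b c) :
    invFourier μ b = c := by
  have he : ∃ c, IsInvFourier μ b c := ⟨c, h⟩
  rw [invFourier, dif_pos he]
  exact he.choose_spec.unique μ h

/-! ### Approximate units -/

theorem exists_nhds_norm_sub_le (b : C_c(G, ℂ)) {ε : ℝ} (hε : 0 < ε) :
    ∃ V ∈ 𝓝 (1 : G), ∀ x, ∀ u ∈ V, ‖b (x * u) - b x‖ ≤ ε := by
  let _ : UniformSpace G := IsTopologicalGroup.leftUniformSpace G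
  have h := b.hasCompactSupport.uniformContinuous_of_continuous b.continuous
  have h2 := h (Metric.dist_mem_uniformity hε)
  obtain ⟨V, hV, hVs⟩ := h2
  refine ⟨V, hV, fun x u hu => ?_⟩
  have hm : (x, x * u) ∈ (fun p : G × G => p.1⁻¹ * p.2) ⁻¹' V := by simpa using hu
  have h3 : dist (b x) (b (x * u)) < ε := hVs hm
  rw [← dist_eq_norm, dist_comm]
  exact h3.le

/-- `f ≥ 0` is symmetric and has integral one. -/
structure IsSymmetricUnit (f : C_c(G, ℂ)) : Prop where
  ofReal_norm : ∀ x, (‖f x‖ : ℂ) = f x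
  inv : ∀ x, f x⁻¹ = f x
  integral_norm : ∫ x, ‖f x‖ ∂μ = 1

theorem exists_isSymmetricUnit {U : Set G} (hU : U ∈ 𝓝 (1 : G)) :
    ∃ f : C_c(G, ℂ), IsSymmetricUnit μ f ∧ ∀ x, f x ≠ 0 → x ∈ U := by
  obtain ⟨k, hk1, hk0, hkc, hk⟩ := exists_continuous_one_zero_of_isCompact
    (isCompact_singleton (x := (1 : G))) (isOpen_interior (s := U)).isClosed_compl
    (Set.disjoint_compl_right_iff_subset.2
      (Set.singleton_subset_iff.2 (mem_interior_iff_mem_nhds.2 hU)))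
  have hk1 : k 1 = 1 := hk1 rfl
  have hc : Continuous fun x => k x * k x⁻¹ := by fun_prop
  have hs : HasCompactSupport fun x => k x * k x⁻¹ := hkc.mul_right
  have hn (x : G) : 0 ≤ k x * k x⁻¹ := mul_nonneg (hk x).1 (hk x⁻¹).1
  have hpos : 0 < ∫ x, k x * k x⁻¹ ∂μ :=
    hc.integral_pos_of_hasCompactSupport_nonneg_nonzero hs hn (x := 1) (by simp [hk1])
  set I := ∫ x, k x * k x⁻¹ ∂μ with hI
  have hn' (x : G) : 0 ≤ I⁻¹ * (k x * k x⁻¹) := mul_nonneg (inv_nonneg.2 hpos.le) (hn x)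
  refine ⟨⟨⟨fun x => ((I⁻¹ * (k x * k x⁻¹) : ℝ) : ℂ), by fun_prop⟩,
    (hs.mul_left (f := fun _ => I⁻¹)).comp_left (g := fun r : ℝ => (r : ℂ)) Complex.ofReal_zero⟩,
    ⟨fun x => ?_, fun x => ?_, ?_⟩, fun x hx => ?_⟩
  · change (‖((I⁻¹ * (k x * k x⁻¹) : ℝ) : ℂ)‖ : ℂ) = ((I⁻¹ * (k x * k x⁻¹) : ℝ) : ℂ)
    rw [Complex.norm_of_nonneg (hn' x)]
  · change ((I⁻¹ * (k x⁻¹ * k x⁻¹⁻¹) : ℝ) : ℂ) = ((I⁻¹ * (k x * k x⁻¹) : ℝ) : ℂ)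
    rw [inv_inv, mul_comm (k x⁻¹)]
  · change ∫ x, ‖((I⁻¹ * (k x * k x⁻¹) : ℝ) : ℂ)‖ ∂μ = 1
    simp_rw [Complex.norm_of_nonneg (hn' _)]
    rw [integral_const_mul, ← hI, inv_mul_cancel₀ hpos.ne']
  · by_contra hxU
    refine hx ?_
    have : k x = 0 := hk0 fun h => hxU (interior_subset h)
    change ((I⁻¹ * (k x * k x⁻¹) : ℝ) : ℂ) = 0
    simp [this]

/-- A net of symmetric functions `f ≥ 0` with integral one, with supports shrinking to `1`. -/
def IsApproxUnit {ι : Type*} (l : Filter ι) (F : ι → C_c(G, ℂ)) : Prop :=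
  ∀ V ∈ 𝓝 (1 : G), ∀ᶠ i in l, IsSymmetricUnit μ (F i) ∧ ∀ x, F i x ≠ 0 → x ∈ V

theorem exists_isApproxUnit :
    ∃ (l : Filter (Set G)) (F : Set G → C_c(G, ℂ)), l.NeBot ∧ IsApproxUnit μ l F := by
  have h (U : Set G) : ∃ f : C_c(G, ℂ), U ∈ 𝓝 (1 : G) →
      IsSymmetricUnit μ f ∧ ∀ x, f x ≠ 0 → x ∈ U := by
    by_cases hU : U ∈ 𝓝 (1 : G)
    · obtain ⟨f, hf⟩ := exists_isSymmetricUnit μ hU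
      exact ⟨f, fun _ => hf⟩
    · exact ⟨0, fun h => absurd h hU⟩
  choose F hF using h
  refine ⟨(𝓝 (1 : G)).smallSets ⊓ 𝓟 {U | U ∈ 𝓝 (1 : G)}, F,
    frequently_mem_iff_neBot.1 (frequently_smallSets_mem _), fun V hV => ?_⟩
  rw [eventually_inf_principal, eventually_smallSets]
  exact ⟨V, hV, fun U hUV hU => ⟨(hF U hU).1, fun x hx => hUV ((hF U hU).2 x hx)⟩⟩

variable {μ}

theorem IsSymmetricUnit.integral {f : C_c(G, ℂ)} (hf : IsSymmetricUnit μ f) :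
    ∫ x, f x ∂μ = 1 := by
  have h : ∫ x, f x ∂μ = ∫ x, (‖f x‖ : ℂ) ∂μ := by simp_rw [hf.ofReal_norm]
  rw [h, integral_complex_ofReal, hf.integral_norm, Complex.ofReal_one]

theorem IsSymmetricUnit.star_apply {f : C_c(G, ℂ)} (hf : IsSymmetricUnit μ f) (x : G) :
    star (f x) = f x := by
  rw [← hf.ofReal_norm x]
  exact Complex.conj_ofReal _

theorem IsSymmetricUnit.inv_mul {f : C_c(G, ℂ)} (hf : IsSymmetricUnit μ f) (x y : G) :
    f (x⁻¹ * y) = f (y⁻¹ * x) := by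
  rw [← hf.inv, mul_inv_rev, inv_inv]

theorem IsSymmetricUnit.leftConv_ae {f : C_c(G, ℂ)} (hf : IsSymmetricUnit μ f) (h : C_c(G, ℂ)) :
    ∀ᵐ x ∂μ, leftConv μ h (toL2 μ f) x = ∫ z, h (x * z) * f z ∂μ := by
  filter_upwards [LCGroupFourier.leftConv_ae μ h f] with x hx
  rw [hx, ← integral_mul_left_eq_self _ x]
  refine integral_congr_ae (Eventually.of_forall fun z => ?_)
  simp only [mul_inv_rev, inv_mul_cancel_right, hf.inv]

/-- Averaging against `‖f‖` a function which is close to `c` on the support of `f`. -/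
theorem IsSymmetricUnit.norm_integral_sub_le {f : C_c(G, ℂ)} (hf : IsSymmetricUnit μ f) {g : G → ℂ}
    (hg : AEStronglyMeasurable g μ) {c : ℂ} {ε : ℝ}
    (h : ∀ᵐ u ∂μ, f u ≠ 0 → ‖g u - c‖ ≤ ε) :
    ‖∫ u, g u * f u ∂μ - c‖ ≤ ε := by
  have hb : ∀ᵐ u ∂μ, ‖(g u - c) * f u‖ ≤ ε * ‖f u‖ := by
    filter_upwards [h] with u hu
    rw [norm_mul]
    by_cases hfu : f u = 0
    · simp [hfu]
    · exact mul_le_mul_of_nonneg_right (hu hfu) (norm_nonneg _)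
  have hi : Integrable (fun u => ε * ‖f u‖) μ := (integrable_cc μ f).norm.const_mul ε
  have hi2 : Integrable (fun u => (g u - c) * f u) μ :=
    hi.mono' ((hg.sub aestronglyMeasurable_const).mul f.continuous.aestronglyMeasurable) hb
  have hi3 : Integrable (fun u => c * f u) μ := (integrable_cc μ f).const_mul c
  have he : ∫ u, g u * f u ∂μ - c = ∫ u, (g u - c) * f u ∂μ := by
    have h1 : ∫ u, g u * f u ∂μ = ∫ u, ((g u - c) * f u + c * f u) ∂μ := by
      refine integral_congr_ae (Eventually.of_forall fun u => ?_)
      ring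
    rw [h1, integral_add hi2 hi3, integral_const_mul, hf.integral]
    ring
  rw [he]
  refine (norm_integral_le_of_norm_le hi hb).trans (le_of_eq ?_)
  rw [integral_const_mul, hf.integral_norm, mul_one]

theorem IsSymmetricUnit.norm_leftConv_sub_le {f : C_c(G, ℂ)} (hf : IsSymmetricUnit μ f)
    (h : C_c(G, ℂ)) {V : Set G} (hfV : ∀ x, f x ≠ 0 → x ∈ V) {ε : ℝ}
    (hV : ∀ x, ∀ u ∈ V, ‖h (x * u) - h x‖ ≤ ε) :
    ∀ᵐ x ∂μ, ‖leftConv μ h (toL2 μ f) x - h x‖ ≤ ε := by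
  filter_upwards [hf.leftConv_ae h] with x hx
  rw [hx]
  refine hf.norm_integral_sub_le ?_ (Eventually.of_forall fun u hu => hV x u (hfV u hu))
  exact (h.continuous.comp (continuous_const.mul continuous_id)).aestronglyMeasurable

variable (μ)

open scoped Pointwise in
theorem integrable_conv_and_integral {k f : G → ℝ} (hk : Continuous k) (hkc : HasCompactSupport k)
    (hf : Continuous f) (hfc : HasCompactSupport f) :
    Integrable (fun x => ∫ z, k z * f (z⁻¹ * x) ∂μ) μ ∧
      ∫ x, ∫ z, k z * f (z⁻¹ * x) ∂μ ∂μ = (∫ x, k x ∂μ) * ∫ x, f x ∂μ := by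
  have hcont : Continuous fun p : G × G => k p.2 * f (p.2⁻¹ * p.1) := by fun_prop
  have hsupp : ∀ x z, ¬ (z ∈ tsupport k ∧ x ∈ tsupport k * tsupport f) →
      k z * f (z⁻¹ * x) = 0 := by
    intro x z hxz
    by_cases hz : z ∈ tsupport k
    · have : z⁻¹ * x ∉ tsupport f := fun h => hxz ⟨hz, z, hz, _, h, by simp⟩
      rw [image_eq_zero_of_notMem_tsupport this, mul_zero]
    · rw [image_eq_zero_of_notMem_tsupport hz, zero_mul]
  constructor
  · refine Continuous.integrable_of_hasCompactSupport ?_ ?_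
    · rw [← continuousOn_univ]
      exact continuousOn_integral_of_compact_support hkc hcont.continuousOn
        fun x z _ hz => hsupp x z fun h => hz h.1
    · exact HasCompactSupport.intro (IsCompact.mul hkc hfc) fun x hx =>
        integral_eq_zero_of_ae (Eventually.of_forall fun z => hsupp x z fun h => hx h.2)
  · rw [integral_integral_swap_of_hasCompactSupport (f := fun x z => k z * f (z⁻¹ * x)) hcont
      (HasCompactSupport.intro ((IsCompact.mul hkc hfc).prod hkc)
        fun p hp => hsupp p.1 p.2 fun h => hp ⟨h.2, h.1⟩)]
    simp_rw [integral_const_mul, integral_mul_left_eq_self f, integral_mul_const]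

variable {μ}

theorem IsSymmetricUnit.norm_inner_leftConv_le {f : C_c(G, ℂ)} (hf : IsSymmetricUnit μ f)
    (h k : C_c(G, ℂ)) :
    ‖⟪leftConv μ h (toL2 μ f), toL2 μ k⟫_ℂ‖ ≤ (‖toL2 μ h‖ ^ 2 + ‖toL2 μ k‖ ^ 2) / 2 := by
  have sqc (g : C_c(G, ℂ)) : Continuous fun x => ‖g x‖ ^ 2 := g.continuous.norm.pow 2
  have sqs (g : C_c(G, ℂ)) : HasCompactSupport fun x => ‖g x‖ ^ 2 :=
    g.hasCompactSupport.comp_left (g := fun z : ℂ => ‖z‖ ^ 2) (by simp)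
  have sqi (g : C_c(G, ℂ)) : Integrable (fun x => ‖g x‖ ^ 2) μ :=
    (sqc g).integrable_of_hasCompactSupport (sqs g)
  have hfn : Continuous fun x => ‖f x‖ := f.continuous.norm
  obtain ⟨hi, hint⟩ := integrable_conv_and_integral μ (sqc k) (sqs k) hfn f.hasCompactSupport.norm
  rw [inner_leftConv_left]
  have hb : ∀ z, ‖star (h z) * ⟪leftTranslate z (toL2 μ f), toL2 μ k⟫_ℂ‖ ≤
      (‖h z‖ ^ 2 + ∫ x, ‖k x‖ ^ 2 * ‖f (x⁻¹ * z)‖ ∂μ) / 2 := by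
    intro z
    have hfz : Integrable (fun x => ‖f (z⁻¹ * x)‖) μ :=
      (integrable_cc μ f).norm.comp_mul_left z⁻¹
    have hkf : Integrable (fun x => ‖k x‖ ^ 2 * ‖f (x⁻¹ * z)‖) μ := by
      refine Continuous.integrable_of_hasCompactSupport ?_ (sqs k).mul_right
      have := f.continuous
      have := k.continuous
      fun_prop
    rw [inner_leftTranslate_toL2, ← integral_const_mul]
    refine (norm_integral_le_of_norm_le (((hfz.const_mul (‖h z‖ ^ 2)).add hkf).div_const 2)
      ?_).trans (le_of_eq ?_)
    · filter_upwards [toL2_ae μ k] with x hx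
      rw [hx, norm_mul, norm_mul, norm_star, norm_star, Pi.add_apply, hf.inv_mul x z]
      nlinarith [mul_nonneg (sq_nonneg (‖h z‖ - ‖k x‖)) (norm_nonneg (f (z⁻¹ * x)))]
    · rw [integral_div, integral_add' (hfz.const_mul _) hkf, integral_const_mul,
        integral_mul_left_eq_self (fun x => ‖f x‖), hf.integral_norm, mul_one]
  refine (norm_integral_le_of_norm_le (((sqi h).add hi).div_const 2)
    (Eventually.of_forall hb)).trans (le_of_eq ?_)
  rw [integral_div, integral_add' (sqi h) hi, hint, hf.integral_norm, mul_one, norm_toL2_sq,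
    norm_toL2_sq]

theorem IsSymmetricUnit.norm_leftConv_le {f : C_c(G, ℂ)} (hf : IsSymmetricUnit μ f)
    (h : C_c(G, ℂ)) : ‖leftConv μ h (toL2 μ f)‖ ≤ ‖toL2 μ h‖ := by
  set u := leftConv μ h (toL2 μ f) with hu
  have key : ‖⟪u, u⟫_ℂ‖ ≤ (‖toL2 μ h‖ ^ 2 + ‖u‖ ^ 2) / 2 :=
    (denseRange_toL2 μ).induction_on (p := fun k : H μ => ‖⟪u, k⟫_ℂ‖ ≤
      (‖toL2 μ h‖ ^ 2 + ‖k‖ ^ 2) / 2) u (isClosed_le (by fun_prop) (by fun_prop))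
      fun k => hf.norm_inner_leftConv_le h k
  rw [inner_self_eq_norm_sq_to_K] at key
  simp only [norm_pow, RCLike.norm_ofReal, abs_norm] at key
  nlinarith [norm_nonneg u, norm_nonneg (toL2 μ h)]

/-! ### Convergence along approximate units -/

/-- A net which converges weakly on a dense set, to a vector of at least its norm, converges. -/
theorem tendsto_of_inner_tendsto_of_norm_le {K : Type*} [NormedAddCommGroup K]
    [InnerProductSpace ℂ K] {α ι : Type*} {l : Filter ι} {e : α → K} (he : DenseRange e)
    {v : ι → K} {u : K} (hb : ∀ᶠ i in l, ‖v i‖ ≤ ‖u‖)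
    (h : ∀ a, Tendsto (fun i => ⟪e a, v i⟫_ℂ) l (𝓝 ⟪e a, u⟫_ℂ)) : Tendsto v l (𝓝 u) := by
  rw [Metric.tendsto_nhds]
  intro ε hε
  have hu : 0 < 2 * ‖u‖ + 1 := by positivity
  set δ : ℝ := ε ^ 2 / (4 * (2 * ‖u‖ + 1)) with hδ
  have hδ0 : 0 < δ := by positivity
  have hδε : δ * (4 * (2 * ‖u‖ + 1)) = ε ^ 2 := div_mul_cancel₀ _ (by positivity)
  obtain ⟨a, ha⟩ := he.exists_dist_lt u hδ0
  rw [dist_eq_norm] at ha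
  filter_upwards [hb, Metric.tendsto_nhds.1 (h a) δ hδ0] with i hi hai
  rw [dist_eq_norm, ← inner_sub_right] at hai
  have h1 : ‖⟪u - e a, v i - u⟫_ℂ‖ ≤ δ * (2 * ‖u‖) := by
    refine (norm_inner_le_norm _ _).trans ?_
    have := norm_sub_le (v i) u
    exact mul_le_mul ha.le (by linarith) (norm_nonneg _) hδ0.le
  have h2 : ‖⟪u, v i - u⟫_ℂ‖ < δ * (2 * ‖u‖ + 1) := by
    have : ⟪u, v i - u⟫_ℂ = ⟪u - e a, v i - u⟫_ℂ + ⟪e a, v i - u⟫_ℂ := by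
      rw [← inner_add_left, sub_add_cancel]
    rw [this]
    refine (norm_add_le _ _).trans_lt ?_
    linarith
  have h3 : ‖v i‖ ^ 2 = ‖u‖ ^ 2 + 2 * RCLike.re ⟪u, v i - u⟫_ℂ + ‖v i - u‖ ^ 2 := by
    rw [← norm_add_sq (𝕜 := ℂ), add_sub_cancel]
  have h4 : -RCLike.re ⟪u, v i - u⟫_ℂ ≤ ‖⟪u, v i - u⟫_ℂ‖ :=
    (neg_le_abs _).trans (RCLike.abs_re_le_norm _)
  have h5 : ‖v i‖ ^ 2 ≤ ‖u‖ ^ 2 := by gcongr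
  rw [dist_eq_norm]
  refine lt_of_pow_lt_pow_left₀ 2 hε.le ?_
  linarith [pow_pos hε 2]

variable {ι : Type*} {l : Filter ι} {F : ι → C_c(G, ℂ)}

theorem IsApproxUnit.tendsto_leftConv (hF : IsApproxUnit μ l F) (h : C_c(G, ℂ)) :
    Tendsto (fun i => leftConv μ h (toL2 μ (F i))) l (𝓝 (toL2 μ h)) := by
  refine tendsto_of_inner_tendsto_of_norm_le (denseRange_toL2 μ)
    ((hF Set.univ univ_mem).mono fun i hi => hi.1.norm_leftConv_le h) fun k => ?_
  rw [Metric.tendsto_nhds]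
  intro ε hε
  have hk : 0 ≤ ∫ x, ‖k x‖ ∂μ := integral_nonneg fun x => norm_nonneg _
  set δ : ℝ := ε / (∫ x, ‖k x‖ ∂μ + 1) with hδ
  have hδ0 : 0 < δ := by positivity
  have hδε : δ * (∫ x, ‖k x‖ ∂μ + 1) = ε := div_mul_cancel₀ _ (by positivity)
  obtain ⟨V, hV, hVh⟩ := exists_nhds_norm_sub_le h hδ0
  filter_upwards [hF V hV] with i ⟨hi, hiV⟩
  rw [dist_eq_norm, ← inner_sub_right, inner_toL2]
  have hb : ∀ᵐ x ∂μ, ‖star (k x) * (leftConv μ h (toL2 μ (F i)) - toL2 μ h : H μ) x‖ ≤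
      δ * ‖k x‖ := by
    filter_upwards [Lp.coeFn_sub (leftConv μ h (toL2 μ (F i))) (toL2 μ h), toL2_ae μ h,
      hi.norm_leftConv_sub_le h hiV hVh] with x h1 h2 h3
    rw [norm_mul, norm_star, h1, Pi.sub_apply, h2, mul_comm]
    gcongr
  refine (norm_integral_le_of_norm_le ((integrable_cc μ k).norm.const_mul δ) hb).trans_lt ?_
  rw [integral_const_mul]
  linarith

theorem IsSymmetricUnit.inner_of_isLeftConvBy {f : C_c(G, ℂ)} (hf : IsSymmetricUnit μ f) {ξ : H μ}
    {y : H μ →L[ℂ] H μ} (hy : IsLeftConvBy μ ξ y) (h : C_c(G, ℂ)) :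
    ⟪toL2 μ h, y (toL2 μ f)⟫_ℂ = ⟪leftConv μ h (toL2 μ f), ξ⟫_ℂ := by
  rw [inner_toL2, inner_leftConv_left]
  refine integral_congr_ae ?_
  filter_upwards [hy f] with x hx
  rw [hx, inner_leftTranslate_toL2]
  congr 2
  funext z
  rw [hf.star_apply, hf.inv_mul, mul_comm]

theorem IsSymmetricUnit.norm_le_of_isLeftConvBy {f : C_c(G, ℂ)} (hf : IsSymmetricUnit μ f)
    {ξ : H μ} {y : H μ →L[ℂ] H μ} (hy : IsLeftConvBy μ ξ y) : ‖y (toL2 μ f)‖ ≤ ‖ξ‖ := by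
  set u := y (toL2 μ f) with hu
  have key : ‖⟪u, u⟫_ℂ‖ ≤ ‖u‖ * ‖ξ‖ :=
    (denseRange_toL2 μ).induction_on (p := fun k : H μ => ‖⟪k, u⟫_ℂ‖ ≤ ‖k‖ * ‖ξ‖) u
      (isClosed_le (by fun_prop) (by fun_prop)) fun h => by
        rw [hu, hf.inner_of_isLeftConvBy hy]
        exact (norm_inner_le_norm _ _).trans (by gcongr; exact hf.norm_leftConv_le h)
  rw [inner_self_eq_norm_sq_to_K] at key
  simp only [norm_pow, RCLike.norm_ofReal, abs_norm] at key
  by_cases h0 : ‖u‖ = 0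
  · rw [h0]
    exact norm_nonneg _
  · have : 0 < ‖u‖ := lt_of_le_of_ne (norm_nonneg _) (Ne.symm h0)
    nlinarith

theorem IsApproxUnit.tendsto_of_isLeftConvBy (hF : IsApproxUnit μ l F) {ξ : H μ}
    {y : H μ →L[ℂ] H μ} (hy : IsLeftConvBy μ ξ y) :
    Tendsto (fun i => y (toL2 μ (F i))) l (𝓝 ξ) := by
  refine tendsto_of_inner_tendsto_of_norm_le (denseRange_toL2 μ)
    ((hF Set.univ univ_mem).mono fun i hi => hi.1.norm_le_of_isLeftConvBy hy) fun h => ?_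
  refine ((hF.tendsto_leftConv h).inner tendsto_const_nhds).congr' ?_
  filter_upwards [hF Set.univ univ_mem] with i hi
  rw [hi.1.inner_of_isLeftConvBy hy]

/-! ### The Plancherel weight -/

theorem isLeftConvBy_leftConv (b : C_c(G, ℂ)) : IsLeftConvBy μ (toL2 μ b) (leftConv μ b) := by
  intro f
  filter_upwards [leftConv_ae μ b f] with x hx
  rw [hx]
  refine integral_congr_ae ?_
  filter_upwards [toL2_ae μ b] with z hz
  rw [hz]

theorem IsApproxUnit.tendsto_inner_adjoint_comp (hF : IsApproxUnit μ l F) {ξ : H μ}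
    {y : H μ →L[ℂ] H μ} (hy : IsLeftConvBy μ ξ y) :
    Tendsto (fun i => ⟪toL2 μ (F i), (ContinuousLinearMap.adjoint y).comp y (toL2 μ (F i))⟫_ℂ) l
      (𝓝 ((‖ξ‖ ^ 2 : ℝ) : ℂ)) := by
  have h := hF.tendsto_of_isLeftConvBy hy
  have h2 := h.inner (𝕜 := ℂ) h
  simp only [ContinuousLinearMap.comp_apply, ContinuousLinearMap.adjoint_inner_right]
  rw [inner_self_eq_norm_sq_to_K] at h2
  push_cast
  exact h2

theorem dualHaarWeight_adjoint_comp {ξ : H μ} {y : H μ →L[ℂ] H μ} (hyM : y ∈ groupVN μ)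
    (hy : IsLeftConvBy μ ξ y) :
    dualHaarWeight μ ((ContinuousLinearMap.adjoint y).comp y) = ‖ξ‖ₑ ^ 2 := by
  refine le_antisymm (iInf₂_le_of_le y ξ (iInf₂_le_of_le hyM hy (iInf_le _ rfl))) ?_
  refine le_iInf₂ fun z ζ => le_iInf₂ fun _ hz => le_iInf fun h => ?_
  obtain ⟨l, F, hl, hF⟩ := exists_isApproxUnit μ
  have h1 := hF.tendsto_inner_adjoint_comp hy
  rw [h] at h1
  have h2 := Complex.ofReal_injective
    (tendsto_nhds_unique h1 (hF.tendsto_inner_adjoint_comp hz))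
  have h3 : ‖ξ‖ = ‖ζ‖ := (pow_left_inj₀ (norm_nonneg _) (norm_nonneg _) two_ne_zero).1 h2
  rw [← ofReal_norm, ← ofReal_norm, h3]

theorem IsApproxUnit.tendsto_dualHaarWeight (hF : IsApproxUnit μ l F) {T : H μ →L[ℂ] H μ}
    (hT : dualHaarWeight μ T < ∞) :
    Tendsto (fun i => ⟪toL2 μ (F i), T (toL2 μ (F i))⟫_ℂ) l
      (𝓝 ((dualHaarWeight μ T).toReal : ℂ)) := by
  simp only [dualHaarWeight, iInf_lt_iff] at hT
  obtain ⟨y, ξ, hyM, hy, rfl, -⟩ := hT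
  rw [dualHaarWeight_adjoint_comp hyM hy, ENNReal.toReal_pow, toReal_enorm]
  exact hF.tendsto_inner_adjoint_comp hy

theorem IsApproxUnit.tendsto_hasWeight (hF : IsApproxUnit μ l F) {T : H μ →L[ℂ] H μ} {w : ℂ}
    (hT : HasWeight (dualHaarWeight μ) T w) :
    Tendsto (fun i => ⟪toL2 μ (F i), T (toL2 μ (F i))⟫_ℂ) l (𝓝 w) := by
  obtain ⟨p, hp, rfl, rfl⟩ := hT
  simp only [sum_apply, smul_apply, inner_sum, inner_smul_right]
  exact tendsto_finsetSum _ fun k _ => (hF.tendsto_dualHaarWeight (hp k)).const_mul _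

/-- The operators `L_c* L_b` belong to the definition domain of the Plancherel weight. -/
theorem exists_hasWeight_adjoint_leftConv_comp (b c : C_c(G, ℂ)) :
    ∃ w, HasWeight (dualHaarWeight μ)
      ((ContinuousLinearMap.adjoint (leftConv μ c)).comp (leftConv μ b)) w := by
  set d : ℕ → C_c(G, ℂ) := fun k => (2⁻¹ : ℂ) • (b + Complex.I ^ k • c) with hd
  refine ⟨_, fun k => (ContinuousLinearMap.adjoint (leftConv μ (d k))).comp (leftConv μ (d k)),
    fun k => ?_, ?_, rfl⟩
  · rw [dualHaarWeight_adjoint_comp (leftConv_mem_groupVN μ _) (isLeftConvBy_leftConv _)]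
    exact ENNReal.pow_lt_top enorm_lt_top
  · ext1 v
    refine ext_inner_left ℂ fun u => ?_
    have h2 : (starRingEnd ℂ) 2 = 2 := map_ofNat _ 2
    simp only [smul_apply, inner_smul_right,
      ContinuousLinearMap.comp_apply, ContinuousLinearMap.adjoint_inner_right, hd, leftConv_smul,
      leftConv_add, add_apply, inner_add_left, inner_add_right, inner_smul_left, Fin.sum_univ_four]
    simp [Complex.I_pow_three, h2]
    ring_nf
    simp only [Complex.I_sq]
    ring

/-! ### The inverse Fourier transform -/

theorem IsSymmetricUnit.norm_inner_leftTranslate_sub_le {f : C_c(G, ℂ)} (hf : IsSymmetricUnit μ f)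
    (b : C_c(G, ℂ)) {V : Set G} (hfV : ∀ x, f x ≠ 0 → x ∈ V) {ε : ℝ}
    (hV : ∀ x, ∀ u ∈ V, ‖b (x * u) - b x‖ ≤ ε) (x : G) :
    ‖⟪leftTranslate x (toL2 μ f), leftConv μ b (toL2 μ f)⟫_ℂ - b x‖ ≤ 2 * ε := by
  set g := leftConv μ b (toL2 μ f) with hg
  have hq := (measurePreserving_mul_left μ x).quasiMeasurePreserving
  have he : ⟪leftTranslate x (toL2 μ f), g⟫_ℂ = ∫ u, g (x * u) * f u ∂μ := by
    rw [inner_leftTranslate_toL2, ← integral_mul_left_eq_self _ x]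
    refine integral_congr_ae (Eventually.of_forall fun u => ?_)
    simp only [inv_mul_cancel_left, hf.star_apply, mul_comm]
  rw [he]
  refine hf.norm_integral_sub_le
    ((Lp.aestronglyMeasurable g).comp_quasiMeasurePreserving hq) ?_
  filter_upwards [hq.ae (hf.norm_leftConv_sub_le b hfV hV)] with u hu hfu
  have h1 := hV x u (hfV u hfu)
  have h2 := norm_add_le (g (x * u) - b (x * u)) (b (x * u) - b x)
  rw [sub_add_sub_cancel] at h2
  rw [← hg] at hu
  change ‖g (x * u) - b x‖ ≤ 2 * ε
  linarith

theorem IsApproxUnit.tendsto_inner_sliceFst (hF : IsApproxUnit μ l F) (b : C_c(G, ℂ))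
    {Y : HH μ →L[ℂ] HH μ} (hY : IsAmplSnd (leftConv μ b) Y) (ζ η : H μ) :
    Tendsto (fun i => ⟪toL2 μ (F i), sliceFst ζ η ((ContinuousLinearMap.adjoint (W μ)).comp Y)
      (toL2 μ (F i))⟫_ℂ) l (𝓝 ⟪η, piOp μ b ζ⟫_ℂ) := by
  have hgi : Integrable (fun x => star (η x) * ζ x) μ := by
    refine (L2.integrable_inner (𝕜 := ℂ) η ζ).congr (Eventually.of_forall fun x => ?_)
    simp only [RCLike.inner_apply', starRingEnd_apply]
  have hlim : ⟪η, piOp μ b ζ⟫_ℂ = ∫ x, star (η x) * ζ x * b x ∂μ := by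
    rw [L2.inner_def]
    refine integral_congr_ae ?_
    filter_upwards [piOp_ae μ b ζ] with x hx
    rw [hx, RCLike.inner_apply', starRingEnd_apply]
    ring
  have hbi : Integrable (fun x => star (η x) * ζ x * b x) μ := by
    obtain ⟨C, hC⟩ := b.continuous.bounded_above_of_compact_support b.hasCompactSupport
    exact hgi.mul_bdd b.continuous.aestronglyMeasurable (Eventually.of_forall hC)
  rw [hlim, Metric.tendsto_nhds]
  intro ε hε
  have hI : 0 ≤ ∫ x, ‖star (η x) * ζ x‖ ∂μ := integral_nonneg fun x => norm_nonneg _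
  set δ : ℝ := ε / (2 * (∫ x, ‖star (η x) * ζ x‖ ∂μ + 1)) with hδ
  have hδ0 : 0 < δ := by positivity
  have hδε : δ * (2 * (∫ x, ‖star (η x) * ζ x‖ ∂μ + 1)) = ε := div_mul_cancel₀ _ (by positivity)
  obtain ⟨V, hV, hVb⟩ := exists_nhds_norm_sub_le b hδ0
  filter_upwards [hF V hV] with i ⟨hi, hiV⟩
  have hint : Integrable (fun x => star (η x) * ζ x *
      ⟪leftTranslate x (toL2 μ (F i)), leftConv μ b (toL2 μ (F i))⟫_ℂ) μ :=
    hgi.mul_bdd (continuous_leftTranslate_inner μ _ _).aestronglyMeasurable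
      (Eventually.of_forall (norm_inner_leftTranslate_le μ _ _))
  rw [inner_sliceFst_W μ b hY, dist_eq_norm, ← integral_sub hint hbi]
  refine (norm_integral_le_of_norm_le (hgi.norm.mul_const (2 * δ))
    (Eventually.of_forall fun x => ?_)).trans_lt ?_
  · rw [← mul_sub, norm_mul]
    gcongr
    exact hi.norm_inner_leftTranslate_sub_le b hiV hVb x
  · rw [integral_mul_const]
    linarith

/-- For `ζ, η ∈ C_c(G)`, the slice `(ω ⊗ id)(W* (1 ⊗ L_b))` is `L_c* L_b` with `c = conj ζ η`. -/
theorem exists_hasWeight_sliceFst (b ζ η : C_c(G, ℂ)) {Y : HH μ →L[ℂ] HH μ}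
    (hY : IsAmplSnd (leftConv μ b) Y) :
    ∃ w, HasWeight (dualHaarWeight μ)
      (sliceFst (toL2 μ ζ) (toL2 μ η) ((ContinuousLinearMap.adjoint (W μ)).comp Y)) w := by
  set c : C_c(G, ℂ) := ⟨⟨fun x => star (ζ x) * η x, by
    have := ζ.continuous
    have := η.continuous
    fun_prop⟩, η.hasCompactSupport.mul_left⟩ with hc
  convert exists_hasWeight_adjoint_leftConv_comp (μ := μ) b c using 3
  ext1 v
  refine ext_inner_left ℂ fun u => ?_
  rw [inner_sliceFst_W μ b hY, ContinuousLinearMap.comp_apply,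
    ContinuousLinearMap.adjoint_inner_right, inner_leftConv_left]
  refine integral_congr_ae ?_
  filter_upwards [toL2_ae μ ζ, toL2_ae μ η] with x h1 h2
  rw [h1, h2]
  change _ = star (star (ζ x) * η x) * _
  rw [star_mul, star_star]

variable (μ)

theorem isInvFourier_leftConv (b : C_c(G, ℂ)) : IsInvFourier μ (leftConv μ b) (piOp μ b) := by
  obtain ⟨Y, hY⟩ := exists_amplSnd μ (leftConv μ b)
  refine ⟨leftConv_mem_groupVN μ b, Y, hY, piOp_mem_Linfty μ b, fun ζ η w hw => ?_,
    fun T _ hT => ?_⟩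
  · obtain ⟨l, F, hl, hF⟩ := exists_isApproxUnit μ
    exact tendsto_nhds_unique (hF.tendsto_inner_sliceFst b hY ζ η) (hF.tendsto_hasWeight hw)
  · ext1 ζ
    refine ext_inner_left ℂ fun η => ?_
    rw [zero_apply, inner_zero_right]
    refine (denseRange_toL2 μ).induction_on₂ (p := fun ζ η : H μ => ⟪η, T ζ⟫_ℂ = 0)
      (isClosed_eq (by fun_prop) continuous_const) (fun ζ η => ?_) ζ η
    exact hT _ _ (exists_hasWeight_sliceFst b ζ η hY)

end

end LCGroupFourier

theorem mainTheorem9 {G : Type*} [Group G] [TopologicalSpace G] [IsTopologicalGroup G]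
    [LocallyCompactSpace G] [T2Space G] [MeasurableSpace G] [BorelSpace G]
    (μ : Measure G) [μ.IsHaarMeasure] [μ.Regular] :
    (∀ a : C_c(G, ℂ),
      LCGroupFourier.piOp μ a ∈ LCGroupFourier.Linfty μ ∧
      LCGroupFourier.leftConv μ a ∈ LCGroupFourier.groupVN μ ∧
      LCGroupFourier.piOp μ a ∈ LCGroupFourier.fourierDomain μ ∧
      LCGroupFourier.fourier μ (LCGroupFourier.piOp μ a) = LCGroupFourier.leftConv μ a) ∧
    (∀ b : C_c(G, ℂ),
      LCGroupFourier.leftConv μ b ∈ LCGroupFourier.groupVN μ ∧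
      LCGroupFourier.piOp μ b ∈ LCGroupFourier.Linfty μ ∧
      LCGroupFourier.leftConv μ b ∈ LCGroupFourier.invFourierDomain μ ∧
      LCGroupFourier.invFourier μ (LCGroupFourier.leftConv μ b) = LCGroupFourier.piOp μ b) ∧
    (∀ a : C_c(G, ℂ),
      LCGroupFourier.invFourier μ (LCGroupFourier.fourier μ (LCGroupFourier.piOp μ a)) =
        LCGroupFourier.piOp μ a) ∧
    (∀ b : C_c(G, ℂ),
      LCGroupFourier.fourier μ (LCGroupFourier.invFourier μ (LCGroupFourier.leftConv μ b)) =
        LCGroupFourier.leftConv μ b) := by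
  have hF := fun a : C_c(G, ℂ) => LCGroupFourier.isFourier_piOp μ a
  have hI := fun b : C_c(G, ℂ) => LCGroupFourier.isInvFourier_leftConv μ b
  refine ⟨fun a => ⟨LCGroupFourier.piOp_mem_Linfty μ a, LCGroupFourier.leftConv_mem_groupVN μ a,
      ⟨_, hF a⟩, (hF a).fourier_eq⟩,
    fun b => ⟨LCGroupFourier.leftConv_mem_groupVN μ b, LCGroupFourier.piOp_mem_Linfty μ b,
      ⟨_, hI b⟩, (hI b).invFourier_eq⟩, fun a => ?_, fun b => ?_⟩
  · rw [(hF a).fourier_eq, (hI a).invFourier_eq]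
  · rw [(hI b).invFourier_eq, (hF b).fourier_eq]
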